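/- Let $\mathcal A$ be a point configuration in $\mathbb R^d$, that is, a finite multiset of points of $\mathbb R^d$ (repeated points are distinguished by labels, and subconfigurations are sets of labels), and suppose that $\mathcal A$ affinely spans $\mathbb R^d$. A subconfiguration $F$ of a subconfiguration $B\subseteq\mathcal A$ is a face of $B$ if $F=\{b\in B : b\in G\}$ for some face $G$ of the polytope $\operatorname{conv} B$ (the polytope itself and the empty set count as faces). A subdivision of $\mathcal A$ is a collection $\Sigma$ of subconfigurations (called the faces of $\Sigma$) such that (1) every face of an $F\in\Sigma$ belongs to $\Sigma$; (2) $\operatorname{conv}\mathcal A=\bigcup_{F\in\Sigma}\operatorname{conv}F$; (3) $\operatorname{relint}(\operatorname{conv}F)\cap\operatorname{relint}(\operatorname{conv}F')=\emptyset$ for all distinct $F,F'\in\Sigma$. The trivial subdivision consists of all faces of $\mathcal A$. A subdivision $\Sigma'$ coarsens $\Sigma$ if every $F\in\Sigma$ is contained in some $F'\in\Sigma'$. A subdivision $\Sigma$ is coarsest if it is not trivial and every subdivision that coarsens it equals $\Sigma$ or the trivial subdivision. A face $F\in\Sigma$ is interior if $\operatorname{conv}F$ is not contained in the boundary of $\operatorname{conv}\mathcal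 A$; its codimension is $d-\dim\operatorname{aff}F$. A $k$-split of $\mathcal A$ is a coarsest subdivision with exactly $k$ inclusion-maximal faces that has an interior face of codimension $k-1$. For a weight function $w:\mathcal A\to\mathbb R$ put $$\mathcal L_w(\mathcal A)=\operatorname{conv}\{(w(a),a) : a\in\mathcal A\}+\mathbb R_{\ge 0}\,(1,0,\dots,0)\subset\mathbb R\times\mathbb R^d .$$ The regular subdivision induced by $w$ consists of the sets $\{b\in\mathcal A : (w(b),b)\in G\}$, where $G$ ranges over the bounded faces of $\mathcal L_w(\mathcal A)$. A subdivision is regular if it is induced by some weight function. **Theorem.** For every $k$, every $k$-split of $\mathcal A$ is a regular subdivision. -/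

import Mathlib

namespace PointConfig

/-!
A point configuration in `ℝ^d` (a finite multiset of points) is a family `a : ι → ℝ^d` over a
finite type `ι` of labels, and a subconfiguration is a set of labels.
-/

variable {d : ℕ} {ι : Type*}

/-- The convex hull of the subconfiguration with label set `F`. -/
def conv (a : ι → EuclideanSpace ℝ (Fin d)) (F : Set ι) : Set (EuclideanSpace ℝ (Fin d)) :=
  convexHull ℝ (a '' F)

/-- `F` is a face of the subconfiguration `B`: it consists of all elements of `B` that lie on some
(exposed) face of the polytope `conv B`. As usual, `B` itself and `∅` count as faces. -/
def IsFace (a : ι → EuclideanSpace ℝ (Fin d)) (F B : Set ι) : Prop :=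
  ∃ G, IsExposed ℝ (conv a B) G ∧ F = {i | i ∈ B ∧ a i ∈ G}

/-- A collection `S` of subconfigurations is a subdivision of the configuration `a`. -/
structure IsSubdivision (a : ι → EuclideanSpace ℝ (Fin d)) (S : Set (Set ι)) : Prop where
  face_mem : ∀ B ∈ S, ∀ F, IsFace a F B → F ∈ S
  iUnion_conv : conv a Set.univ = ⋃ F ∈ S, conv a F
  disjoint_relint : ∀ F ∈ S, ∀ F' ∈ S, F ≠ F' →
    Disjoint (intrinsicInterior ℝ (conv a F)) (intrinsicInterior ℝ (conv a F'))

/-- The trivial subdivision: all faces of the configuration, including the whole configuration. -/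
def trivialSubdivision (a : ι → EuclideanSpace ℝ (Fin d)) : Set (Set ι) :=
  {F | IsFace a F Set.univ}

/-- `S` refines `T` (equivalently, `T` coarsens `S`). -/
def Refines (S T : Set (Set ι)) : Prop :=
  ∀ F ∈ S, ∃ G ∈ T, F ⊆ G

/-- A coarsest subdivision: a non-trivial subdivision whose only proper coarsening is the trivial
subdivision. -/
structure IsCoarsest (a : ι → EuclideanSpace ℝ (Fin d)) (S : Set (Set ι)) : Prop where
  isSubdivision : IsSubdivision a S
  ne_trivial : S ≠ trivialSubdivision a
  coarsening : ∀ T, IsSubdivision a T → Refines S T → T = S ∨ T = trivialSubdivision a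

/-- A subconfiguration is interior if its convex hull is not entirely contained in the boundary of
the convex hull of the whole configuration. -/
def IsInterior (a : ι → EuclideanSpace ℝ (Fin d)) (F : Set ι) : Prop :=
  ¬ conv a F ⊆ frontier (conv a Set.univ)

/-- The dimension of (the affine hull of) a subconfiguration. -/
noncomputable def dim (a : ι → EuclideanSpace ℝ (Fin d)) (F : Set ι) : ℕ :=
  Module.finrank ℝ (vectorSpan ℝ (a '' F))

/-- A `k`-split of a `d`-dimensional configuration in `ℝ^d`: a coarsest subdivision with exactly `k`
inclusion-maximal faces that has an interior face of codimension `k - 1`, that is, of dimension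
`d - (k - 1)`. -/
structure IsKSplit (a : ι → EuclideanSpace ℝ (Fin d)) (k : ℕ) (S : Set (Set ι)) : Prop where
  isCoarsest : IsCoarsest a S
  ncard_maximal : {F | Maximal (· ∈ S) F}.ncard = k
  exists_interior : ∃ F ∈ S, IsInterior a F ∧ dim a F + k = d + 1

/-- The lifted polyhedron `conv {(w i, a i)} + ℝ_{≥0} (1, 0)` in `ℝ × ℝ^d`. -/
def lift (a : ι → EuclideanSpace ℝ (Fin d)) (w : ι → ℝ) : Set (ℝ × EuclideanSpace ℝ (Fin d)) :=
  {x | ∃ y ∈ convexHull ℝ (Set.range fun i => (w i, a i)), ∃ t : ℝ, 0 ≤ t ∧ x = y + (t, 0)}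

/-- The regular subdivision induced by `w`: the label sets of the lower (that is, bounded) faces of
the lifted polyhedron. -/
def regularSubdivision (a : ι → EuclideanSpace ℝ (Fin d)) (w : ι → ℝ) : Set (Set ι) :=
  {F | ∃ G, IsExposed ℝ (lift a w) G ∧ Bornology.IsBounded G ∧ F = {i | (w i, a i) ∈ G}}

/-- A collection of subconfigurations is a regular subdivision if some weight function induces it. -/
def IsRegular (a : ι → EuclideanSpace ℝ (Fin d)) (S : Set (Set ι)) : Prop :=
  ∃ w : ι → ℝ, S = regularSubdivision a w

end PointConfig

namespace PointConfig
open Set Filter Topology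

variable {d : ℕ} {ι : Type*}

/-- `z` is a convex combination of the points of `B` in which every label of `B` has a strictly
positive coefficient. -/
def IsPosComb [Fintype ι] (a : ι → EuclideanSpace ℝ (Fin d)) (B : Set ι)
    (z : EuclideanSpace ℝ (Fin d)) : Prop :=
  ∃ c : ι → ℝ, (∀ i ∈ B, 0 < c i) ∧ (∀ i ∉ B, c i = 0) ∧ ∑ i, c i = 1 ∧ ∑ i, c i • a i = z

/-- `F` consists of the labels of `B` at which a linear functional attains an upper bound. -/
def IsLinFace (a : ι → EuclideanSpace ℝ (Fin d)) (F B : Set ι) : Prop :=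
  ∃ (f : EuclideanSpace ℝ (Fin d) →ₗ[ℝ] ℝ) (c : ℝ), (∀ i ∈ B, f (a i) ≤ c) ∧
    ∀ i, i ∈ F ↔ i ∈ B ∧ f (a i) = c

variable {a : ι → EuclideanSpace ℝ (Fin d)} {B F G : Set ι} {z y : EuclideanSpace ℝ (Fin d)}

theorem convex_conv : Convex ℝ (conv a B) := convex_convexHull ℝ _

theorem mem_conv_of_mem {i : ι} (hi : i ∈ B) : a i ∈ conv a B :=
  subset_convexHull ℝ _ (mem_image_of_mem a hi)

theorem conv_mono (h : F ⊆ B) : conv a F ⊆ conv a B :=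
  convexHull_mono (image_mono h)

theorem isClosed_conv [Finite ι] : IsClosed (conv a B) :=
  ((toFinite (a '' B)).isCompact_convexHull (𝕜 := ℝ)).isClosed

theorem mem_conv_of_sum [Fintype ι] {c : ι → ℝ} (h0 : ∀ i, 0 ≤ c i) (hB : ∀ i ∉ B, c i = 0)
    (h1 : ∑ i, c i = 1) : ∑ i, c i • a i ∈ conv a B := by
  classical
  have e1 : ∑ i with i ∈ B, c i = ∑ i, c i :=
    Finset.sum_filter_of_ne fun i _ hi => by by_contra h; exact hi (hB i h)
  have e2 : ∑ i with i ∈ B, c i • a i = ∑ i, c i • a i :=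
    Finset.sum_filter_of_ne fun i _ hi => by by_contra h; exact hi (by simp [hB i h])
  rw [← e2]
  exact convex_conv.sum_mem (fun i _ => h0 i) (by rw [e1, h1]) fun i hi =>
    mem_conv_of_mem (by simpa using hi)

theorem mem_conv_iff [Fintype ι] : z ∈ conv a B ↔
    ∃ c : ι → ℝ, (∀ i, 0 ≤ c i) ∧ (∀ i ∉ B, c i = 0) ∧ ∑ i, c i = 1 ∧ ∑ i, c i • a i = z := by
  classical
  constructor
  · have hc : Convex ℝ {z | ∃ c : ι → ℝ, (∀ i, 0 ≤ c i) ∧ (∀ i ∉ B, c i = 0) ∧ ∑ i, c i = 1 ∧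
        ∑ i, c i • a i = z} := by
      rintro x ⟨c, c0, cB, c1, rfl⟩ y ⟨e, e0, eB, e1, rfl⟩ s t hs ht hst
      refine ⟨fun i => s * c i + t * e i, fun i => ?_, fun i hi => ?_, ?_, ?_⟩
      · have := c0 i
        have := e0 i
        positivity
      · simp [cB i hi, eB i hi]
      · rw [Finset.sum_add_distrib, ← Finset.mul_sum, ← Finset.mul_sum, c1, e1, mul_one, mul_one,
          hst]
      · simp [add_smul, mul_smul, Finset.sum_add_distrib, Finset.smul_sum]
    refine fun hz => convexHull_min ?_ hc hz
    rintro _ ⟨i, hi, rfl⟩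
    refine ⟨Pi.single i 1, fun j => ?_, fun j hj => ?_, by simp, ?_⟩
    · by_cases h : j = i
      · subst h; simp
      · simp [h]
    · have : j ≠ i := fun h => hj (h ▸ hi)
      simp [this]
    · simp [Pi.single_apply]
  · rintro ⟨c, h0, hB, h1, rfl⟩
    exact mem_conv_of_sum h0 hB h1

theorem IsPosComb.mem_conv [Fintype ι] (h : IsPosComb a B z) : z ∈ conv a B := by
  obtain ⟨c, hp, hB, h1, hz⟩ := h
  refine mem_conv_iff.2 ⟨c, fun i => ?_, hB, h1, hz⟩
  by_cases hi : i ∈ B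
  · exact (hp i hi).le
  · exact (hB i hi).ge

theorem IsPosComb.nonempty [Fintype ι] (h : IsPosComb a B z) : B.Nonempty := by
  obtain ⟨c, hp, hB, h1, hz⟩ := h
  by_contra hne
  rw [not_nonempty_iff_eq_empty] at hne
  subst hne
  simp [hB] at h1

theorem exists_isPosComb [Fintype ι] (h : B.Nonempty) : ∃ z, IsPosComb a B z := by
  classical
  have hc : 0 < (Finset.univ.filter (· ∈ B)).card := by
    obtain ⟨i, hi⟩ := h
    exact Finset.card_pos.2 ⟨i, by simpa using hi⟩
  refine ⟨_, fun i => if i ∈ B then ((Finset.univ.filter (· ∈ B)).card : ℝ)⁻¹ else 0,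
    fun i hi => ?_, fun i hi => ?_, ?_, rfl⟩
  · simp only [hi, if_true]; positivity
  · simp [hi]
  · rw [← Finset.sum_filter, Finset.sum_const, nsmul_eq_mul]
    field_simp

/-- A point with positive coefficients can be pushed away from any other point of the hull. -/
theorem IsPosComb.exists_push [Fintype ι] (h : IsPosComb a B z) (hy : y ∈ conv a B) :
    ∃ δ > 0, ∀ ε : ℝ, 0 ≤ ε → ε ≤ δ → z + ε • (z - y) ∈ conv a B := by
  classical
  obtain ⟨c, hp, hB, h1, rfl⟩ := h
  obtain ⟨e, e0, eB, e1, rfl⟩ := mem_conv_iff.1 hy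
  have hc0 : ∀ i, 0 ≤ c i := fun i => by
    by_cases hi : i ∈ B
    · exact (hp i hi).le
    · exact (hB i hi).ge
  have he1 : ∀ i, e i ≤ 1 := fun i =>
    e1 ▸ Finset.single_le_sum (fun j _ => e0 j) (Finset.mem_univ i)
  obtain ⟨δ, hδ, hδc⟩ : ∃ δ > 0, ∀ i ∈ B, δ ≤ c i := by
    have : ∀ᶠ δ in 𝓝[>] (0 : ℝ), ∀ i : ι, i ∈ B → δ ≤ c i := by
      rw [eventually_all]
      intro i
      by_cases hi : i ∈ B
      · filter_upwards [Ioo_mem_nhdsGT (hp i hi)] with δ hδ _ using hδ.2.le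
      · exact Eventually.of_forall fun _ h => absurd h hi
    obtain ⟨δ, h1, h2⟩ := (this.and self_mem_nhdsWithin).exists
    exact ⟨δ, h2, h1⟩
  refine ⟨δ, hδ, fun ε hε hεδ => mem_conv_iff.2
    ⟨fun i => c i + ε * (c i - e i), fun i => ?_, fun i hi => ?_, ?_, ?_⟩⟩
  · by_cases hi : i ∈ B
    · have := hδc i hi
      have := he1 i
      have := hc0 i
      nlinarith [mul_nonneg hε this, mul_le_mul_of_nonneg_left (he1 i) hε]
    · simp [hB i hi, eB i hi]
  · simp [hB i hi, eB i hi]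
  · rw [Finset.sum_add_distrib, ← Finset.mul_sum, Finset.sum_sub_distrib, h1, e1]; ring
  · simp [add_smul, sub_smul, mul_smul, Finset.sum_add_distrib, Finset.smul_sum,
      Finset.sum_sub_distrib, smul_sub]

theorem IsPosComb.mem_intrinsicInterior [Fintype ι] (h : IsPosComb a B z) :
    z ∈ intrinsicInterior ℝ (conv a B) := by
  obtain ⟨y, hy⟩ := Set.Nonempty.intrinsicInterior convex_conv ⟨z, h.mem_conv⟩
  have hys : y ∈ conv a B := intrinsicInterior_subset hy
  obtain ⟨y', hy', rfl⟩ := hy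
  have : Nonempty (affineSpan ℝ (conv a B)) := ⟨y'⟩
  obtain ⟨δ, hδ, hpush⟩ := h.exists_push hys
  have hw := hpush δ hδ.le le_rfl
  set w := z + δ • (z - (y' : EuclideanSpace ℝ (Fin d))) with hwdef
  let w' : affineSpan ℝ (conv a B) := ⟨w, subset_affineSpan ℝ _ hw⟩
  have ht : δ / (1 + δ) ≠ 0 := by positivity
  have hval : ∀ x : affineSpan ℝ (conv a B),
      ((AffineMap.homothety w' (δ / (1 + δ)) x : affineSpan ℝ (conv a B)) :
        EuclideanSpace ℝ (Fin d)) = (δ / (1 + δ)) • ((x : EuclideanSpace ℝ (Fin d)) - w) + w := by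
    intro x
    rfl
  refine ⟨AffineMap.homothety w' (δ / (1 + δ)) y', ?_, ?_⟩
  · have hop := AffineMap.homothety_isOpenMap w' (δ / (1 + δ)) ht
    refine mem_interior.2 ⟨_, ?_, hop _ isOpen_interior, mem_image_of_mem _ hy'⟩
    rintro _ ⟨x, hx, rfl⟩
    rw [mem_preimage, hval]
    have hx' : (x : EuclideanSpace ℝ (Fin d)) ∈ conv a B :=
      interior_subset (s := Subtype.val ⁻¹' conv a B) hx
    have := (convex_conv : Convex ℝ (conv a B)) hx' hw (a := δ / (1 + δ)) (b := 1 / (1 + δ))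
      (by positivity) (by positivity) (by field_simp; ring)
    convert this using 1
    match_scalars <;> field_simp <;> ring
  · rw [hval, hwdef]
    match_scalars <;> field_simp <;> ring

theorem le_of_mem_conv {f : EuclideanSpace ℝ (Fin d) →ₗ[ℝ] ℝ} {c : ℝ} (h : ∀ i ∈ B, f (a i) ≤ c)
    (hz : z ∈ conv a B) : f z ≤ c := by
  refine convexHull_min (t := {x | f x ≤ c}) ?_ (convex_halfSpace_le f.isLinear c) hz
  rintro _ ⟨i, hi, rfl⟩
  exact h i hi

theorem eq_of_mem_conv {f : EuclideanSpace ℝ (Fin d) →ₗ[ℝ] ℝ} {c : ℝ} (h : ∀ i ∈ B, f (a i) = c)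
    (hz : z ∈ conv a B) : f z = c := by
  refine convexHull_min (t := {x | f x = c}) ?_ (convex_hyperplane f.isLinear c) hz
  rintro _ ⟨i, hi, rfl⟩
  exact h i hi

theorem mem_conv_eq [Fintype ι] {f : EuclideanSpace ℝ (Fin d) →ₗ[ℝ] ℝ} {c : ℝ}
    (h : ∀ i ∈ B, f (a i) ≤ c) (hz : z ∈ conv a B) (hfz : f z = c) :
    z ∈ conv a {i | i ∈ B ∧ f (a i) = c} := by
  obtain ⟨e, e0, eB, e1, rfl⟩ := mem_conv_iff.1 hz
  refine mem_conv_of_sum e0 (fun i hi => ?_) e1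
  by_cases hiB : i ∈ B
  · have hs : ∑ i, e i * (c - f (a i)) = 0 := by
      simp only [mul_sub, Finset.sum_sub_distrib, ← Finset.sum_mul, e1, one_mul]
      rw [← hfz]; simp
    have hn : ∀ i ∈ Finset.univ, 0 ≤ e i * (c - f (a i)) := fun i _ => by
      by_cases hi : i ∈ B
      · exact mul_nonneg (e0 i) (sub_nonneg.2 (h i hi))
      · simp [eB i hi]
    rcases mul_eq_zero.1 ((Finset.sum_eq_zero_iff_of_nonneg hn).1 hs i (Finset.mem_univ i)) with
      h' | h'
    · exact h'
    · exact absurd ⟨hiB, by linarith⟩ hi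
  · exact eB i hiB

theorem IsLinFace.subset (h : IsLinFace a F B) : F ⊆ B := by
  obtain ⟨f, c, -, hF⟩ := h
  exact fun i hi => ((hF i).1 hi).1

theorem IsLinFace.refl : IsLinFace a B B := ⟨0, 0, by simp, by simp⟩

theorem IsLinFace.isFace (h : IsLinFace a F B) : IsFace a F B := by
  obtain ⟨f, c, hle, hF⟩ := h
  rcases F.eq_empty_or_nonempty with rfl | ⟨j, hj⟩
  · exact ⟨∅, isExposed_empty, by simp⟩
  · obtain ⟨hjB, hjc⟩ := (hF j).1 hj
    refine ⟨_, ContinuousLinearMap.toExposed.isExposed (l := f.toContinuousLinearMap), ?_⟩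
    ext i
    simp only [hF i, ContinuousLinearMap.toExposed, mem_ofPred_eq]
    refine and_congr_right fun hi => ⟨fun h => ⟨mem_conv_of_mem hi, fun y hy => ?_⟩, fun h => ?_⟩
    · simpa [h] using le_of_mem_conv hle hy
    · refine le_antisymm (hle i hi) ?_
      simpa [hjc] using h.2 _ (mem_conv_of_mem hjB)

theorem IsLinFace.trans [Finite ι] (h₁ : IsLinFace a F G) (h₂ : IsLinFace a G B) :
    IsLinFace a F B := by
  obtain ⟨f, c, hf, hF⟩ := h₁
  obtain ⟨g, e, hg, hG⟩ := h₂
  have : ∀ᶠ M in atTop, ∀ i : ι, i ∈ B → i ∉ G → f (a i) - c < M * (e - g (a i)) := by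
    rw [eventually_all]
    intro i
    by_cases hi : i ∈ B ∧ i ∉ G
    · have hpos : 0 < e - g (a i) := by
        have h1 := hg i hi.1
        have h2 : g (a i) ≠ e := fun h => hi.2 ((hG i).2 ⟨hi.1, h⟩)
        exact sub_pos.2 (lt_of_le_of_ne h1 h2)
      filter_upwards [(tendsto_id.atTop_mul_const hpos).eventually_gt_atTop (f (a i) - c)]
        with M hM _ _ using hM
    · exact Eventually.of_forall fun M h1 h2 => absurd ⟨h1, h2⟩ hi
  obtain ⟨M, hM⟩ := this.exists
  have key : ∀ i ∈ B, i ∉ G → (M • g + f) (a i) < M * e + c := fun i hi hi' => by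
    have := hM i hi hi'
    simp only [LinearMap.add_apply, LinearMap.smul_apply, smul_eq_mul]
    linarith
  have key' : ∀ i ∈ G, (M • g + f) (a i) = M * e + f (a i) := fun i hi => by
    simp [((hG i).1 hi).2]
  refine ⟨M • g + f, M * e + c, fun i hi => ?_, fun i => ⟨fun hi => ?_, fun hi => ?_⟩⟩
  · by_cases hiG : i ∈ G
    · rw [key' i hiG]; linarith [hf i hiG]
    · exact (key i hi hiG).le
  · have hi' := (hF i).1 hi
    refine ⟨((hG i).1 hi'.1).1, ?_⟩
    rw [key' i hi'.1, hi'.2]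
  · by_cases hiG : i ∈ G
    · refine (hF i).2 ⟨hiG, ?_⟩
      have := hi.2
      rw [key' i hiG] at this
      linarith
    · exact absurd hi.2 (key i hi.1 hiG).ne

/-- Hulls of faces are extreme. -/
theorem IsLinFace.mem_conv_of_combo [Fintype ι] (h : IsLinFace a F B) (hy : y ∈ conv a B)
    (hz : z ∈ conv a B) {s t : ℝ} (hs : 0 < s) (ht : 0 ≤ t) (hst : s + t = 1)
    (hm : s • y + t • z ∈ conv a F) : y ∈ conv a F := by
  obtain ⟨f, c, hf, hF⟩ := h
  have hFeq : F = {i | i ∈ B ∧ f (a i) = c} := by ext i; exact hF i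
  have h1 := eq_of_mem_conv (fun i hi => ((hF i).1 hi).2) hm
  have h2 := le_of_mem_conv hf hy
  have h3 := le_of_mem_conv hf hz
  rw [hFeq]
  refine mem_conv_eq hf hy (le_antisymm h2 ?_)
  simp only [map_add, map_smul, smul_eq_mul] at h1
  have : s * c ≤ s * f y := by
    have h4 : s * c + t * c = c := by rw [← add_mul, hst, one_mul]
    linarith [mul_le_mul_of_nonneg_left h3 ht]
  exact le_of_mul_le_mul_left this hs

theorem IsLinFace.mem_of_mem_conv (h : IsLinFace a F B) {i : ι} (hi : i ∈ B)
    (hm : a i ∈ conv a F) : i ∈ F := by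
  obtain ⟨f, c, hf, hF⟩ := h
  exact (hF i).2 ⟨hi, eq_of_mem_conv (fun i hi => ((hF i).1 hi).2) hm⟩

/-- If a face contains a positive combination of a subset, then it contains the subset. -/
theorem IsLinFace.subset_of_isPosComb [Fintype ι] (h : IsLinFace a F B) (hG : G ⊆ B)
    (hz : IsPosComb a G z) (hm : z ∈ conv a F) : G ⊆ F := by
  intro i hi
  obtain ⟨δ, hδ, hp⟩ := hz.exists_push (mem_conv_of_mem hi)
  have h2 := conv_mono hG (hp δ hδ.le le_rfl)
  refine h.mem_of_mem_conv (hG hi) (h.mem_conv_of_combo (mem_conv_of_mem (hG hi)) h2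
    (s := δ / (1 + δ)) (t := 1 / (1 + δ)) (by positivity) (by positivity) (by field_simp; ring) ?_)
  convert hm using 1
  match_scalars
  · field_simp
    ring
  · field_simp

/-- A point of the hull that is not a positive combination lies on a proper face. -/
theorem exists_support [Fintype ι] (hz : z ∈ conv a B) (hn : ¬ IsPosComb a B z) :
    ∃ (f : EuclideanSpace ℝ (Fin d) →ₗ[ℝ] ℝ) (c : ℝ), (∀ i ∈ B, f (a i) ≤ c) ∧ f z = c ∧
      ∃ i ∈ B, f (a i) < c := by
  classical
  let T : (B → ℝ) →ₗ[ℝ] EuclideanSpace ℝ (Fin d) :=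
    Fintype.linearCombination ℝ fun i : B => a i - z
  have hT : ∀ c, T c = ∑ i : B, c i • (a i - z) := fun c => by
    simp [T, Fintype.linearCombination_apply]
  let O : Set (B → ℝ) := Set.univ.pi fun _ => Ioi 0
  have hOo : IsOpen O := isOpen_set_pi finite_univ fun _ _ => isOpen_Ioi
  have hOc : Convex ℝ O := convex_pi fun _ _ => convex_Ioi 0
  have hBne : B.Nonempty := by
    by_contra h
    rw [not_nonempty_iff_eq_empty] at h
    simp [h, conv] at hz
  have h0 : (0 : LinearMap.range T) ∉ T.rangeRestrict '' O := by
    rintro ⟨c, hc, hc0⟩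
    have hc' : ∀ i, 0 < c i := fun i => hc i (mem_univ i)
    have hTc : T c = 0 := congrArg Subtype.val hc0
    apply hn
    have : Nonempty B := hBne.to_subtype
    have hs : 0 < ∑ i, c i := Finset.sum_pos (fun i _ => hc' i) Finset.univ_nonempty
    have ext : ∀ {M : Type} [AddCommMonoid M] (g : ι → M), (∀ i ∉ B, g i = 0) →
        ∑ i, g i = ∑ i : B, g i := by
      intro M _ g hg
      rw [← Finset.sum_subtype (Finset.univ.filter (· ∈ B)) (by simp)]
      exact (Finset.sum_filter_of_ne fun i _ hi => by by_contra h; exact hi (hg i h)).symm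
    refine ⟨fun i => if h : i ∈ B then c ⟨i, h⟩ / ∑ i, c i else 0, fun i hi => ?_, fun i hi => ?_,
      ?_, ?_⟩
    · simp only [hi, dif_pos]; exact div_pos (hc' _) hs
    · simp [hi]
    · rw [ext _ (fun i hi => by simp [hi])]
      simp only [Subtype.coe_prop, dif_pos, Subtype.coe_eta]
      rw [← Finset.sum_div, div_self hs.ne']
    · rw [ext _ (fun i hi => by simp [hi])]
      simp only [Subtype.coe_prop, dif_pos, Subtype.coe_eta]
      rw [hT] at hTc
      simp only [smul_sub, Finset.sum_sub_distrib, ← Finset.sum_smul] at hTc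
      simp only [div_eq_inv_mul, mul_smul, ← Finset.smul_sum]
      rw [sub_eq_zero.1 hTc, smul_smul, inv_mul_cancel₀ hs.ne', one_smul]
  have hopen : IsOpen (T.rangeRestrict '' O) :=
    T.rangeRestrict.isOpenMap_of_finiteDimensional T.surjective_rangeRestrict _ hOo
  obtain ⟨f, hf⟩ := geometric_hahn_banach_open_point (hOc.linear_image T.rangeRestrict) hopen h0
  obtain ⟨g, hg⟩ := (f : LinearMap.range T →ₗ[ℝ] ℝ).exists_extend
  have hgT : ∀ c ∈ O, g (T c) < 0 := fun c hc => by
    have h1 := hf _ (mem_image_of_mem _ hc)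
    rw [map_zero] at h1
    have h2 := LinearMap.congr_fun hg (T.rangeRestrict c)
    simp only [LinearMap.comp_apply, Submodule.subtype_apply, LinearMap.codRestrict_apply,
      LinearMap.rangeRestrict] at h2
    rw [h2]
    exact h1
  have hgi : ∀ c : B → ℝ, g (T c) = ∑ i, c i * g (a i - z) := fun c => by rw [hT]; simp
  refine ⟨g, g z, fun i hi => ?_, rfl, ?_⟩
  · by_contra! hlt
    have hpos : 0 < g (a i - z) := by rw [map_sub]; linarith
    have h1 : ∀ t : ℝ, 0 < t → t * g (a i - z) + ∑ j : B, g (a j - z) < 0 := by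
      intro t ht
      have := hgT (fun j => (if j = ⟨i, hi⟩ then t else 0) + 1) (fun j _ => by
        simp only [mem_Ioi]; split_ifs <;> linarith)
      rw [hgi] at this
      simpa [add_mul, Finset.sum_add_distrib] using this
    have h2 := h1 ((|∑ j : B, g (a j - z)| + 1) / g (a i - z)) (by positivity)
    rw [div_mul_cancel₀ _ hpos.ne'] at h2
    linarith [neg_abs_le (∑ j : B, g (a j - z))]
  · by_contra! hge
    have h1 := hgT (fun _ => 1) (fun j _ => by simp)
    rw [hgi] at h1
    refine absurd h1 (not_lt.2 (Finset.sum_nonneg fun j _ => ?_))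
    have := hge j j.2
    rw [map_sub]
    linarith

/-- Every point of the hull is a positive combination of some face. -/
theorem exists_face_isPosComb [Fintype ι] (hz : z ∈ conv a B) :
    ∃ G, IsLinFace a G B ∧ IsPosComb a G z := by
  induction hn : B.ncard using Nat.strong_induction_on generalizing B with
  | _ n ih =>
    by_cases hp : IsPosComb a B z
    · exact ⟨B, IsLinFace.refl, hp⟩
    · obtain ⟨f, c, hf, hfz, i, hi, hlt⟩ := exists_support hz hp
      have hface : IsLinFace a {i | i ∈ B ∧ f (a i) = c} B := ⟨f, c, hf, fun i => Iff.rfl⟩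
      have hss : {i | i ∈ B ∧ f (a i) = c} ⊂ B :=
        ⟨hface.subset, fun h => hlt.ne (h hi).2⟩
      obtain ⟨G, hG, hGz⟩ := ih _ (hn ▸ ncard_lt_ncard hss) (mem_conv_eq hf hz hfz) rfl
      exact ⟨G, hG.trans hface, hGz⟩

end PointConfig

namespace PointConfig
open Set Filter Topology

section Fan

variable {E J : Type*} [AddCommGroup E] [Module ℝ E] [Fintype J] {V : Submodule ℝ E}
  {K : J → Set E} {r : J → E}

theorem sum_smul_mem_cone (hVK : ∀ j, ∀ v ∈ V, v ∈ K j)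
    (hadd : ∀ j, ∀ x ∈ K j, ∀ y ∈ K j, x + y ∈ K j)
    (hsmul : ∀ j, ∀ t : ℝ, 0 < t → ∀ x ∈ K j, t • x ∈ K j) (hr : ∀ i j, r i ∈ K j ↔ i ≠ j)
    {c : J → ℝ} (hc : ∀ i, 0 ≤ c i) {j : J} (hj : c j = 0) : ∑ i, c i • r i ∈ K j := by
  refine Finset.sum_induction _ (· ∈ K j) (fun x y hx hy => hadd j x hx y hy)
    (hVK j 0 V.zero_mem) fun i _ => ?_
  rcases (hc i).eq_or_lt with h | h
  · rw [← h, zero_smul]; exact hVK j 0 V.zero_mem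
  · refine hsmul j _ h _ ((hr i j).2 ?_)
    rintro rfl
    exact h.ne' hj

theorem coeff_eq_zero_of_sum_mem (hVK : ∀ j, ∀ v ∈ V, v ∈ K j)
    (hadd : ∀ j, ∀ x ∈ K j, ∀ y ∈ K j, x + y ∈ K j)
    (hsmul : ∀ j, ∀ t : ℝ, 0 < t → ∀ x ∈ K j, t • x ∈ K j)
    (hext : ∀ j l, ∀ x ∈ K j, ∀ y ∈ K j, x + y ∈ K l → x ∈ K l)
    (hr : ∀ i j, r i ∈ K j ↔ i ≠ j) {c : J → ℝ} (hc : ∀ i, 0 ≤ c i) {j l : J} (hj : c j = 0)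
    {v : E} (hv : v ∈ V) (hl : ∑ i, c i • r i + v ∈ K l) : c l = 0 := by
  classical
  by_contra hne
  have hpos : 0 < c l := lt_of_le_of_ne (hc l) (Ne.symm hne)
  have hlj : l ≠ j := by rintro rfl; exact hne hj
  have hx : c l • r l ∈ K j := hsmul j _ hpos _ ((hr l j).2 hlj)
  have hy : ∑ i, Function.update c l 0 i • r i ∈ K j := by
    refine sum_smul_mem_cone hVK hadd hsmul hr (fun i => ?_) ?_
    · by_cases h : i = l
      · subst h; simp
      · simpa [h] using hc i
    · simpa [hlj.symm] using hj
  have hsum : c l • r l + (∑ i, Function.update c l 0 i • r i + v) = ∑ i, c i • r i + v := by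
    rw [← add_assoc, ← Finset.add_sum_erase _ (fun i => c i • r i) (Finset.mem_univ l),
      ← Finset.add_sum_erase _ (fun i => Function.update c l 0 i • r i) (Finset.mem_univ l)]
    simp only [Function.update_self, zero_smul, zero_add]
    congr 2
    refine Finset.sum_congr rfl fun i hi => ?_
    rw [Function.update_of_ne (Finset.ne_of_mem_erase hi)]
  rw [← hsum] at hl
  have h1 := hext j l _ hx _ (hadd j _ hy _ (hVK j v hv)) hl
  have h2 := hsmul l (c l)⁻¹ (inv_pos.2 hpos) _ h1
  rw [smul_smul, inv_mul_cancel₀ hne, one_smul] at h2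
  exact (hr l l).1 h2 rfl

theorem coeff_nonpos_of_sum_mem (hVK : ∀ j, ∀ v ∈ V, v ∈ K j)
    (hadd : ∀ j, ∀ x ∈ K j, ∀ y ∈ K j, x + y ∈ K j)
    (hsmul : ∀ j, ∀ t : ℝ, 0 < t → ∀ x ∈ K j, t • x ∈ K j)
    (hext : ∀ j l, ∀ x ∈ K j, ∀ y ∈ K j, x + y ∈ K l → x ∈ K l)
    (hr : ∀ i j, r i ∈ K j ↔ i ≠ j) {c : J → ℝ} (hV : ∑ i, c i • r i ∈ V) {j : J}
    (hj : c j ≤ 0) (l : J) : c l ≤ 0 := by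
  by_contra! hl
  have hneg : ∑ i, max (-c i) 0 • r i ∈ K l :=
    sum_smul_mem_cone hVK hadd hsmul hr (fun i => le_max_right _ _) (max_eq_right (by linarith))
  have heq : ∑ i, max (c i) 0 • r i + 0 = ∑ i, max (-c i) 0 • r i + ∑ i, c i • r i := by
    rw [add_zero, ← Finset.sum_add_distrib]
    refine Finset.sum_congr rfl fun i _ => ?_
    rw [← add_smul]
    congr 1
    rcases le_total 0 (c i) with h | h
    · rw [max_eq_left h, max_eq_right (by linarith)]; ring
    · rw [max_eq_right h, max_eq_left (by linarith)]; ring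
  have h0 := coeff_eq_zero_of_sum_mem hVK hadd hsmul hext hr (c := fun i => max (c i) 0)
    (fun i => le_max_right _ _) (j := j) (l := l) (max_eq_right hj) V.zero_mem
    (heq ▸ hadd l _ hneg _ (hVK l _ hV))
  simp only [max_eq_left hl.le] at h0
  exact hl.ne' h0

/-- A fan with lineality space `V` whose number of maximal cones exceeds the dimension modulo `V`
by one carries a strictly convex piecewise linear function. The cones are given by rays `r i`, each
of which lies in all the cones except the `i`-th one. -/
theorem exists_supporting_functionals [FiniteDimensional ℝ E] [Nonempty J]
    (hdim : Module.finrank ℝ E + 1 = Module.finrank ℝ V + Fintype.card J)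
    (hVK : ∀ j, ∀ v ∈ V, v ∈ K j)
    (hadd : ∀ j, ∀ x ∈ K j, ∀ y ∈ K j, x + y ∈ K j)
    (hsmul : ∀ j, ∀ t : ℝ, 0 < t → ∀ x ∈ K j, t • x ∈ K j)
    (hext : ∀ j l, ∀ x ∈ K j, ∀ y ∈ K j, x + y ∈ K l → x ∈ K l)
    (hr : ∀ i j, r i ∈ K j ↔ i ≠ j) :
    ∃ h : J → E →ₗ[ℝ] ℝ, ∀ l, ∀ y ∈ K l, ∀ j, h j y ≤ h l y ∧ (h j y = h l y ↔ y ∈ K j) := by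
  classical
  let Ψ : (J → ℝ) →ₗ[ℝ] E ⧸ V := V.mkQ ∘ₗ Fintype.linearCombination ℝ r
  have hΨ : ∀ c, Ψ c = V.mkQ (∑ i, c i • r i) := fun c => by
    simp [Ψ, Fintype.linearCombination_apply]
  have hker : ∀ c, Ψ c = 0 ↔ ∑ i, c i • r i ∈ V := fun c => by
    rw [hΨ, Submodule.mkQ_apply, Submodule.Quotient.mk_eq_zero]
  have hquot := V.finrank_quotient_add_finrank
  have hlt : Module.finrank ℝ (E ⧸ V) < Module.finrank ℝ (J → ℝ) := by
    rw [Module.finrank_fintype_fun_eq_card]; lia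
  obtain ⟨e, heK, he0⟩ := (Submodule.ne_bot_iff _).1
    (LinearMap.ker_ne_bot_of_finrank_lt (f := Ψ) hlt)
  have hnonpos : ∀ c, Ψ c = 0 → ∀ j, c j ≤ 0 → ∀ l, c l ≤ 0 := fun c hc j hj l =>
    coeff_nonpos_of_sum_mem hVK hadd hsmul hext hr ((hker c).1 hc) hj l
  have hzero : ∀ c, Ψ c = 0 → ∀ j, c j = 0 → c = 0 := by
    intro c hc j hj
    funext l
    have h1 := hnonpos c hc j hj.le l
    have h2 := hnonpos (-c) (by rw [map_neg, hc, neg_zero]) j (by simp [hj]) l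
    simp only [Pi.neg_apply, Left.neg_nonpos_iff] at h2
    exact le_antisymm h1 h2
  obtain ⟨c, hc, hcpos⟩ : ∃ c, Ψ c = 0 ∧ ∀ i, 0 < c i := by
    have heK' : Ψ e = 0 := heK
    by_cases hpos : ∀ i, 0 < e i
    · exact ⟨e, heK', hpos⟩
    · push Not at hpos
      obtain ⟨j, hj⟩ := hpos
      refine ⟨-e, by rw [map_neg, heK', neg_zero], fun i => ?_⟩
      have h1 := hnonpos e heK' j hj i
      have h2 : e i ≠ 0 := fun h => he0 (hzero e heK' i h)
      simpa using lt_of_le_of_ne h1 h2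
  have hkerdim : Module.finrank ℝ (LinearMap.ker Ψ) ≤ 1 := by
    obtain ⟨j⟩ := ‹Nonempty J›
    refine finrank_le_one (⟨c, hc⟩ : LinearMap.ker Ψ) fun b => ⟨(b : J → ℝ) j / c j, ?_⟩
    ext1
    have hb : Ψ b = 0 := b.2
    have := hzero (((b : J → ℝ) j / c j) • c - b) (by simp [hc, hb]) j (by
      simp [div_mul_cancel₀ _ (hcpos j).ne'])
    exact sub_eq_zero.1 this
  have hsurj : LinearMap.range Ψ = ⊤ := by
    apply Submodule.eq_top_of_finrank_eq
    have h1 := Ψ.finrank_range_add_finrank_ker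
    have h2 := Submodule.finrank_le (LinearMap.range Ψ)
    rw [Module.finrank_fintype_fun_eq_card] at h1
    lia
  obtain ⟨σ, hσ⟩ := Ψ.exists_rightInverse_of_surjective hsurj
  let x : E → J → ℝ := fun y => σ (V.mkQ y)
  have hx : ∀ y, y - ∑ i, x y i • r i ∈ V := fun y => by
    have h1 : Ψ (x y) = V.mkQ y := LinearMap.congr_fun hσ (V.mkQ y)
    rw [hΨ] at h1
    exact (Submodule.Quotient.eq V).1 h1.symm
  have hshift : ∀ y (t : ℝ), y - ∑ i, (x y i - t * c i) • r i ∈ V := fun y t => by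
    have h1 := V.add_mem (hx y) (V.smul_mem t ((hker c).1 hc))
    convert h1 using 1
    simp only [sub_smul, mul_smul, Finset.sum_sub_distrib, Finset.smul_sum]
    abel
  have hmem : ∀ y j, (∀ i, x y j / c j ≤ x y i / c i) → y ∈ K j := by
    intro y j hj
    have h1 := sum_smul_mem_cone hVK hadd hsmul hr
      (c := fun i => x y i - x y j / c j * c i) (j := j)
      (fun i => sub_nonneg.2 ((le_div_iff₀ (hcpos i)).1 (hj i)))
      (by rw [div_mul_cancel₀ _ (hcpos j).ne', sub_self])
    simpa using hadd j _ h1 _ (hVK j _ (hshift y (x y j / c j)))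
  have hmin : ∀ l, ∀ y ∈ K l, ∀ i, x y l / c l ≤ x y i / c i := by
    intro l y hy
    obtain ⟨j, hj⟩ := Finite.exists_min fun i => x y i / c i
    have h1 := coeff_eq_zero_of_sum_mem hVK hadd hsmul hext hr
      (c := fun i => x y i - x y j / c j * c i) (j := j) (l := l)
      (fun i => sub_nonneg.2 ((le_div_iff₀ (hcpos i)).1 (hj i)))
      (by rw [div_mul_cancel₀ _ (hcpos j).ne', sub_self]) (hshift y (x y j / c j))
      (by simpa using hy)
    intro i
    have h2 : x y l / c l = x y j / c j := by
      rw [div_eq_iff (hcpos l).ne']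
      linarith
    rw [h2]
    exact hj i
  refine ⟨fun j => -(c j)⁻¹ • (LinearMap.proj j ∘ₗ σ ∘ₗ V.mkQ), fun l y hy j => ?_⟩
  have hval : ∀ i, (-(c i)⁻¹ • ((LinearMap.proj i : (J → ℝ) →ₗ[ℝ] ℝ) ∘ₗ σ ∘ₗ V.mkQ)) y
      = -(x y i / c i) := fun i => by
    simp only [LinearMap.smul_apply, LinearMap.comp_apply, LinearMap.proj_apply, smul_eq_mul, x]
    ring
  simp only [hval, neg_le_neg_iff, neg_inj]
  refine ⟨hmin l y hy j, fun h => hmem y j fun i => h ▸ hmin l y hy i, fun h => ?_⟩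
  exact le_antisymm (hmin j y h l) (hmin l y hy j)

end Fan

end PointConfig

namespace PointConfig
open Set Filter Topology

variable {d : ℕ} {ι : Type*}
variable {a : ι → EuclideanSpace ℝ (Fin d)} {B C F G : Set ι} {x y z : EuclideanSpace ℝ (Fin d)}
  {S : Set (Set ι)}

theorem IsSubdivision.linFace_mem (hS : IsSubdivision a S) (hB : B ∈ S) (h : IsLinFace a F B) :
    F ∈ S :=
  hS.face_mem B hB F h.isFace

section Subdivision

variable [Fintype ι]

theorem IsSubdivision.eq_of_isPosComb (hS : IsSubdivision a S) (hF : F ∈ S) (hG : G ∈ S)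
    (hFz : IsPosComb a F z) (hGz : IsPosComb a G z) : F = G := by
  by_contra h
  exact disjoint_left.1 (hS.disjoint_relint F hF G hG h) hFz.mem_intrinsicInterior
    hGz.mem_intrinsicInterior

theorem IsSubdivision.isLinFace_of_isPosComb (hS : IsSubdivision a S) (hG : G ∈ S) (hB : B ∈ S)
    (hz : IsPosComb a G z) (hzB : z ∈ conv a B) : IsLinFace a G B := by
  obtain ⟨H, hH, hHz⟩ := exists_face_isPosComb hzB
  rwa [hS.eq_of_isPosComb hG (hS.linFace_mem hB hH) hz hHz]

theorem IsSubdivision.isLinFace_of_subset (hS : IsSubdivision a S) (hG : G ∈ S) (hB : B ∈ S)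
    (hGB : G ⊆ B) (hne : G.Nonempty) : IsLinFace a G B := by
  obtain ⟨z, hz⟩ := exists_isPosComb (a := a) hne
  exact hS.isLinFace_of_isPosComb hG hB hz (conv_mono hGB hz.mem_conv)

theorem IsSubdivision.exists_common_face (hS : IsSubdivision a S) (hB : B ∈ S) (hC : C ∈ S)
    (hzB : z ∈ conv a B) (hzC : z ∈ conv a C) :
    ∃ G, IsPosComb a G z ∧ IsLinFace a G B ∧ IsLinFace a G C := by
  obtain ⟨G, hG, hGz⟩ := exists_face_isPosComb hzB
  exact ⟨G, hGz, hG, hS.isLinFace_of_isPosComb (hS.linFace_mem hB hG) hC hGz hzC⟩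

theorem IsSubdivision.isLinFace_inter (hS : IsSubdivision a S) (hB : B ∈ S) (hC : C ∈ S)
    (hne : (B ∩ C).Nonempty) : IsLinFace a (B ∩ C) B := by
  obtain ⟨z, hz⟩ := exists_isPosComb (a := a) hne
  obtain ⟨G, hGz, hGB, hGC⟩ := hS.exists_common_face hB hC
    (conv_mono inter_subset_left hz.mem_conv) (conv_mono inter_subset_right hz.mem_conv)
  rwa [(hGB.subset_of_isPosComb inter_subset_left hz hGz.mem_conv).antisymm
    (subset_inter hGB.subset hGC.subset)]

end Subdivision

/-- The cone of directions that lead from `x` into the hull of `C`. -/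
def dirCone (a : ι → EuclideanSpace ℝ (Fin d)) (x : EuclideanSpace ℝ (Fin d)) (C : Set ι) :
    Set (EuclideanSpace ℝ (Fin d)) :=
  {y | ∃ δ > 0, ∀ ε : ℝ, 0 ≤ ε → ε ≤ δ → x + ε • y ∈ conv a C}

theorem mem_conv_of_mem_dirCone (h : y ∈ dirCone a x C) : x ∈ conv a C := by
  obtain ⟨δ, hδ, h⟩ := h
  simpa using h 0 le_rfl hδ.le

theorem mem_dirCone_of_mem (hx : x ∈ conv a C) {ε : ℝ} (hε : 0 < ε) (h : x + ε • y ∈ conv a C) :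
    y ∈ dirCone a x C := by
  refine ⟨ε, hε, fun t ht htε => ?_⟩
  have := (convex_conv : Convex ℝ (conv a C)) hx h (a := 1 - t / ε) (b := t / ε)
    (sub_nonneg.2 ((div_le_one hε).2 htε)) (by positivity) (by ring)
  convert this using 1
  match_scalars
  · ring
  · field_simp

theorem sub_mem_dirCone (hx : x ∈ conv a C) (hy : y ∈ conv a C) : y - x ∈ dirCone a x C :=
  mem_dirCone_of_mem hx one_pos (by simpa using hy)

theorem zero_mem_dirCone (hx : x ∈ conv a C) : (0 : EuclideanSpace ℝ (Fin d)) ∈ dirCone a x C := by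
  simpa using sub_mem_dirCone hx hx

theorem dirCone_mono (h : B ⊆ C) : dirCone a x B ⊆ dirCone a x C := by
  rintro y ⟨δ, hδ, hy⟩
  exact ⟨δ, hδ, fun ε h0 h1 => conv_mono h (hy ε h0 h1)⟩

theorem smul_mem_dirCone {t : ℝ} (ht : 0 < t) (hy : y ∈ dirCone a x C) :
    t • y ∈ dirCone a x C := by
  have hx := mem_conv_of_mem_dirCone hy
  obtain ⟨δ, hδ, h⟩ := hy
  refine mem_dirCone_of_mem hx (ε := δ / t) (by positivity) ?_
  rw [smul_smul, div_mul_cancel₀ _ ht.ne']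
  exact h δ hδ.le le_rfl

theorem add_mem_dirCone (hy : y ∈ dirCone a x C) (hz : z ∈ dirCone a x C) :
    y + z ∈ dirCone a x C := by
  have hx := mem_conv_of_mem_dirCone hy
  obtain ⟨δ, hδ, h⟩ := hy
  obtain ⟨γ, hγ, h'⟩ := hz
  have hm : 0 < min δ γ := lt_min hδ hγ
  refine mem_dirCone_of_mem hx (ε := min δ γ / 2) (by positivity) ?_
  have := (convex_conv : Convex ℝ (conv a C)) (h _ hm.le (min_le_left _ _))
    (h' _ hm.le (min_le_right _ _)) (a := 1 / 2) (b := 1 / 2) (by norm_num) (by norm_num)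
    (by norm_num)
  convert this using 1
  module

theorem vectorSpan_subset_dirCone [Fintype ι] (hx : IsPosComb a G x)
    (hy : y ∈ vectorSpan ℝ (a '' G)) : y ∈ dirCone a x G := by
  suffices h : y ∈ dirCone a x G ∧ -y ∈ dirCone a x G from h.1
  have hneg : ∀ i ∈ G, x - a i ∈ dirCone a x G := fun i hi => by
    obtain ⟨δ, hδ, h⟩ := hx.exists_push (mem_conv_of_mem hi)
    exact ⟨δ, hδ, h⟩
  have hpos : ∀ i ∈ G, a i - x ∈ dirCone a x G := fun i hi =>
    sub_mem_dirCone hx.mem_conv (mem_conv_of_mem hi)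
  rw [vectorSpan_def] at hy
  induction hy using Submodule.span_induction with
  | mem v hv =>
    obtain ⟨_, ⟨i, hi, rfl⟩, _, ⟨j, hj, rfl⟩, rfl⟩ := hv
    constructor
    · simpa using add_mem_dirCone (hpos i hi) (hneg j hj)
    · simpa using add_mem_dirCone (hpos j hj) (hneg i hi)
  | zero => simpa using zero_mem_dirCone hx.mem_conv
  | add v w _ _ hv hw =>
    refine ⟨add_mem_dirCone hv.1 hw.1, ?_⟩
    rw [neg_add]
    exact add_mem_dirCone hv.2 hw.2
  | smul t v _ hv =>
    rcases lt_trichotomy t 0 with ht | rfl | ht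
    · constructor
      · simpa using smul_mem_dirCone (neg_pos.2 ht) hv.2
      · simpa using smul_mem_dirCone (neg_pos.2 ht) hv.1
    · simpa using zero_mem_dirCone hx.mem_conv
    · refine ⟨smul_mem_dirCone ht hv.1, ?_⟩
      rw [← smul_neg]
      exact smul_mem_dirCone ht hv.2

theorem sub_mem_vectorSpan (hx : x ∈ conv a G) (hy : y ∈ conv a G) :
    y - x ∈ vectorSpan ℝ (a '' G) := by
  rw [← direction_affineSpan]
  exact AffineSubspace.vsub_mem_direction (convexHull_subset_affineSpan _ hy)
    (convexHull_subset_affineSpan _ hx)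

theorem map_eq_zero_of_mem_vectorSpan {f : EuclideanSpace ℝ (Fin d) →ₗ[ℝ] ℝ} {c : ℝ}
    (hf : ∀ i ∈ G, f (a i) = c) (hy : y ∈ vectorSpan ℝ (a '' G)) : f y = 0 := by
  have : vectorSpan ℝ (a '' G) ≤ LinearMap.ker f := by
    rw [vectorSpan_def, Submodule.span_le]
    rintro _ ⟨_, ⟨i, hi, rfl⟩, _, ⟨j, hj, rfl⟩, rfl⟩
    simp [hf i hi, hf j hj]
  exact this hy

theorem nonpos_of_mem_dirCone {f : EuclideanSpace ℝ (Fin d) →ₗ[ℝ] ℝ} {c : ℝ}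
    (hf : ∀ i ∈ C, f (a i) ≤ c) (hx : f x = c) (hy : y ∈ dirCone a x C) : f y ≤ 0 := by
  obtain ⟨δ, hδ, h⟩ := hy
  have := le_of_mem_conv hf (h δ hδ.le le_rfl)
  simp only [map_add, map_smul, smul_eq_mul, hx] at this
  by_contra! hpos
  linarith [mul_pos hδ hpos]

theorem mem_vectorSpan_of_mem_dirCone [Fintype ι] {f : EuclideanSpace ℝ (Fin d) →ₗ[ℝ] ℝ} {c : ℝ}
    (hf : ∀ i ∈ C, f (a i) ≤ c) (hG : ∀ i, i ∈ G ↔ i ∈ C ∧ f (a i) = c) (hx : x ∈ conv a G)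
    (hy : y ∈ dirCone a x C) (hfy : f y = 0) : y ∈ vectorSpan ℝ (a '' G) := by
  obtain ⟨δ, hδ, h⟩ := hy
  have hG' : G = {i | i ∈ C ∧ f (a i) = c} := by ext i; exact hG i
  have hfx := eq_of_mem_conv (fun i hi => ((hG i).1 hi).2) hx
  have h1 : x + δ • y ∈ conv a G := by
    rw [hG']
    exact mem_conv_eq hf (h δ hδ.le le_rfl) (by simp [hfx, hfy])
  have h2 := sub_mem_vectorSpan hx h1
  rw [add_sub_cancel_left] at h2
  simpa [smul_smul, inv_mul_cancel₀ hδ.ne'] using Submodule.smul_mem _ δ⁻¹ h2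

section Cells

variable [Fintype ι]

/-- The direction cones of two faces of a subdivision meet in an extreme subset of each. -/
theorem IsSubdivision.mem_dirCone_of_add_mem (hS : IsSubdivision a S) (hB : B ∈ S) (hC : C ∈ S)
    (hy : y ∈ dirCone a x B) (hz : z ∈ dirCone a x B) (hyz : y + z ∈ dirCone a x C) :
    y ∈ dirCone a x C := by
  have hxC := mem_conv_of_mem_dirCone hyz
  obtain ⟨δ₁, hδ₁, h₁⟩ := hy
  obtain ⟨δ₂, hδ₂, h₂⟩ := hz
  obtain ⟨δ₃, hδ₃, h₃⟩ := hyz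
  have hm : 0 < min (min δ₁ δ₂) δ₃ := lt_min (lt_min hδ₁ hδ₂) hδ₃
  set δ := min (min δ₁ δ₂) δ₃
  have k₁ := h₁ δ hm.le ((min_le_left _ _).trans (min_le_left _ _))
  have k₂ := h₂ δ hm.le ((min_le_left _ _).trans (min_le_right _ _))
  have k₃ := h₃ (δ / 2) (by positivity) ((half_le_self hm.le).trans (min_le_right _ _))
  clear_value δ
  have e : x + (δ / 2) • (y + z) = (1 / 2 : ℝ) • (x + δ • y) + (1 / 2 : ℝ) • (x + δ • z) := by
    module
  have k₄ : x + (δ / 2) • (y + z) ∈ conv a B := by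
    rw [e]
    exact (convex_conv : Convex ℝ (conv a B)) k₁ k₂ (by norm_num) (by norm_num) (by norm_num)
  obtain ⟨G, hG, hGB, hGC⟩ := hS.exists_common_face hB hC k₄ k₃
  refine mem_dirCone_of_mem hxC hm (conv_mono hGC.subset ?_)
  refine hGB.mem_conv_of_combo k₁ k₂ (s := 1 / 2) (t := 1 / 2) (by norm_num) (by norm_num)
    (by norm_num) ?_
  rw [← e]
  exact hG.mem_conv

theorem IsSubdivision.mem_of_sub_mem_dirCone (hS : IsSubdivision a S) (hB : B ∈ S) (hC : C ∈ S)
    (hx : x ∈ conv a B) {i : ι} (hi : i ∈ B) (h : a i - x ∈ dirCone a x C) : i ∈ C := by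
  obtain ⟨δ, hδ, h⟩ := h
  have hm : 0 < min δ 1 := lt_min hδ one_pos
  have k₁ := h _ hm.le (min_le_left _ _)
  have hm1 : min δ 1 ≤ 1 := min_le_right _ _
  set γ := min δ 1
  clear_value γ
  have e : x + γ • (a i - x) = γ • a i + (1 - γ) • x := by module
  have k₂ : x + γ • (a i - x) ∈ conv a B := by
    rw [e]
    exact (convex_conv : Convex ℝ (conv a B)) (mem_conv_of_mem hi) hx hm.le (sub_nonneg.2 hm1)
      (by ring)
  obtain ⟨G, hG, hGB, hGC⟩ := hS.exists_common_face hB hC k₂ k₁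
  refine hGC.subset (hGB.mem_of_mem_conv hi ?_)
  refine hGB.mem_conv_of_combo (mem_conv_of_mem hi) hx hm (sub_nonneg.2 hm1) (by ring) ?_
  rw [← e]
  exact hG.mem_conv

theorem exists_cell_superset (hB : B ∈ S) : ∃ C, Maximal (· ∈ S) C ∧ B ⊆ C := by
  obtain ⟨C, h1, h2⟩ := (toFinite S).exists_le_maximal hB
  exact ⟨C, h2, h1⟩

theorem IsSubdivision.exists_cell (hS : IsSubdivision a S) (hz : z ∈ conv a univ) :
    ∃ C, Maximal (· ∈ S) C ∧ z ∈ conv a C := by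
  rw [hS.iUnion_conv] at hz
  simp only [mem_iUnion] at hz
  obtain ⟨B, hB, hz⟩ := hz
  obtain ⟨C, hC, hBC⟩ := exists_cell_superset hB
  exact ⟨C, hC, conv_mono hBC hz⟩

/-- The direction cones of the maximal faces at an interior point cover the space. -/
theorem IsSubdivision.exists_mem_dirCone (hS : IsSubdivision a S)
    (hx : x ∈ interior (conv a univ)) (y : EuclideanSpace ℝ (Fin d)) :
    ∃ C, Maximal (· ∈ S) C ∧ y ∈ dirCone a x C := by
  have hcont : Tendsto (fun ε : ℝ => x + ε • y) (𝓝[>] 0) (𝓝 x) := by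
    have : Continuous fun ε : ℝ => x + ε • y := by fun_prop
    have h := this.tendsto 0
    simp only [zero_smul, add_zero] at h
    exact h.mono_left nhdsWithin_le_nhds
  have hev : ∀ᶠ ε in 𝓝[>] (0 : ℝ), ∃ C : {C // Maximal (· ∈ S) C}, x + ε • y ∈ conv a C := by
    filter_upwards [hcont (mem_interior_iff_mem_nhds.1 hx)] with ε hε
    obtain ⟨C, hC, h⟩ := hS.exists_cell hε
    exact ⟨⟨C, hC⟩, h⟩
  obtain ⟨C, hC⟩ := frequently_exists.1 hev.frequently
  have hxC : x ∈ conv a C := isClosed_conv.mem_of_frequently_of_tendsto hC hcont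
  obtain ⟨ε, hε, hε0⟩ := (hC.and_eventually self_mem_nhdsWithin).exists
  exact ⟨C, C.2, mem_dirCone_of_mem hxC hε0 hε⟩

/-- An interior face of codimension `m` lies in at least `m + 1` maximal faces. -/
theorem IsSubdivision.le_dim_add_card (hS : IsSubdivision a S) (hG : G ∈ S)
    (hGx : IsPosComb a G x) (hx : x ∈ interior (conv a univ)) :
    d + 1 ≤ dim a G + Nat.card {C : {C // Maximal (· ∈ S) C} // G ⊆ C} := by
  classical
  have hface : ∀ C : {C : {C // Maximal (· ∈ S) C} // G ⊆ C}, IsLinFace a G C := fun C =>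
    hS.isLinFace_of_subset hG C.1.2.prop C.2 hGx.nonempty
  choose f c hf hfG using hface
  by_contra! hlt
  have : Fintype {C : {C // Maximal (· ∈ S) C} // G ⊆ C} := Fintype.ofFinite _
  obtain ⟨C₀, hC₀, hGC₀⟩ := exists_cell_superset hG
  rw [Nat.card_eq_fintype_card] at hlt
  obtain ⟨y, hyV, hy⟩ : ∃ y ∉ vectorSpan ℝ (a '' G), ∀ C, 0 ≤ f C y := by
    by_cases hker : LinearMap.ker (LinearMap.pi f) ≤ vectorSpan ℝ (a '' G)
    · have h1 := Submodule.finrank_mono hker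
      have h2 := (LinearMap.pi f).finrank_range_add_finrank_ker
      rw [finrank_euclideanSpace_fin] at h2
      have h3 := Submodule.finrank_le (LinearMap.range (LinearMap.pi f))
      rw [Module.finrank_fintype_fun_eq_card] at h3
      have htop : LinearMap.range (LinearMap.pi f) = ⊤ := by
        apply Submodule.eq_top_of_finrank_eq
        rw [Module.finrank_fintype_fun_eq_card]
        unfold dim at hlt
        refine le_antisymm h3 ?_
        linarith [Nat.lt_succ_iff.1 hlt]
      obtain ⟨y, hy⟩ := LinearMap.range_eq_top.1 htop fun _ => 1
      have hy' : ∀ C, f C y = 1 := fun C => congrFun hy C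
      refine ⟨y, fun hyV => ?_, fun C => by simp [hy']⟩
      have h4 := map_eq_zero_of_mem_vectorSpan
        (fun i hi => ((hfG ⟨⟨C₀, hC₀⟩, hGC₀⟩ i).1 hi).2) hyV
      rw [hy'] at h4
      exact one_ne_zero h4
    · obtain ⟨y, hy, hyV⟩ := SetLike.not_le_iff_exists.1 hker
      exact ⟨y, hyV, fun C => (congrFun hy C).ge⟩
  obtain ⟨C, hC, hyC⟩ := hS.exists_mem_dirCone hx y
  have hGC := (hS.isLinFace_of_isPosComb hG hC.prop hGx (mem_conv_of_mem_dirCone hyC)).subset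
  let D : {C : {C // Maximal (· ∈ S) C} // G ⊆ C} := ⟨⟨C, hC⟩, hGC⟩
  have hfx : f D x = c D := eq_of_mem_conv (fun i hi => ((hfG D i).1 hi).2) hGx.mem_conv
  refine hyV (mem_vectorSpan_of_mem_dirCone (hf D) (hfG D) hGx.mem_conv hyC ?_)
  exact le_antisymm (nonpos_of_mem_dirCone (hf D) hfx hyC) (hy D)

theorem exists_isPosComb_interior (hz : z ∈ conv a G) (hz' : z ∈ interior (conv a univ)) :
    ∃ x, IsPosComb a G x ∧ x ∈ interior (conv a univ) := by
  have hne : G.Nonempty := by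
    by_contra h
    rw [not_nonempty_iff_eq_empty] at h
    simp [h, conv] at hz
  obtain ⟨y, hy⟩ := exists_isPosComb (a := a) hne
  refine ⟨(1 / 2 : ℝ) • z + (1 / 2 : ℝ) • y, ?_, ?_⟩
  · obtain ⟨c, hp, hB, h1, rfl⟩ := hy
    obtain ⟨e, e0, eB, e1, rfl⟩ := mem_conv_iff.1 hz
    refine ⟨fun i => 1 / 2 * e i + 1 / 2 * c i, fun i hi => ?_, fun i hi => ?_, ?_, ?_⟩
    · have := hp i hi
      have := e0 i
      positivity
    · simp [hB i hi, eB i hi]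
    · rw [Finset.sum_add_distrib, ← Finset.mul_sum, ← Finset.mul_sum, h1, e1]; norm_num
    · simp only [add_smul, mul_smul, Finset.sum_add_distrib, Finset.smul_sum]
  · exact convex_conv.combo_interior_self_mem_interior hz' (conv_mono (subset_univ G) hy.mem_conv)
      (by norm_num) (by norm_num) (by norm_num)

theorem IsInterior.exists_isPosComb (h : IsInterior a F) :
    ∃ x, IsPosComb a F x ∧ x ∈ interior (conv a univ) := by
  obtain ⟨z, hz, hz'⟩ := not_subset.1 h
  refine exists_isPosComb_interior hz ?_
  by_contra hi
  exact hz' ⟨subset_closure (conv_mono (subset_univ F) hz), hi⟩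

/-- Tilting a functional that exposes `F` in `C` by a functional constant on `F` until it exposes a
strictly larger face. -/
theorem exists_tilted_face {f g : EuclideanSpace ℝ (Fin d) →ₗ[ℝ] ℝ} {c e : ℝ}
    (hf : ∀ i ∈ C, f (a i) ≤ c) (hF : ∀ i, i ∈ F ↔ i ∈ C ∧ f (a i) = c)
    (hg : ∀ i ∈ F, g (a i) = e) (hne : ∃ p ∈ C, p ∉ F) :
    ∃ t : ℝ, (∀ i ∈ C, g (a i) - e ≤ t * (c - f (a i))) ∧
      IsLinFace a {i | i ∈ C ∧ g (a i) - e = t * (c - f (a i))} C ∧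
      F ⊂ {i | i ∈ C ∧ g (a i) - e = t * (c - f (a i))} := by
  obtain ⟨p, hp, hpmax⟩ := (toFinite (C \ F)).exists_maximalFor
    (fun i => (g (a i) - e) / (c - f (a i))) _ (by
      obtain ⟨p, hp, hpF⟩ := hne
      exact ⟨p, hp, hpF⟩)
  have hpos : ∀ i ∈ C, i ∉ F → 0 < c - f (a i) := fun i hi hiF =>
    sub_pos.2 (lt_of_le_of_ne (hf i hi) fun h => hiF ((hF i).2 ⟨hi, h⟩))
  have hle : ∀ i ∈ C, g (a i) - e ≤ (g (a p) - e) / (c - f (a p)) * (c - f (a i)) := by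
    intro i hi
    by_cases hiF : i ∈ F
    · simp [hg i hiF, ((hF i).1 hiF).2]
    · rw [← div_le_iff₀ (hpos i hi hiF)]
      rcases le_total ((g (a i) - e) / (c - f (a i))) ((g (a p) - e) / (c - f (a p))) with h | h
      · exact h
      · exact hpmax ⟨hi, hiF⟩ h
  refine ⟨(g (a p) - e) / (c - f (a p)), hle, ?_, fun i hi => ⟨((hF i).1 hi).1, ?_⟩, fun h => ?_⟩
  · generalize (g (a p) - e) / (c - f (a p)) = t at hle
    refine ⟨g + t • f, e + t * c, fun i hi => ?_, fun i => and_congr_right fun hi => ?_⟩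
    · have := hle i hi
      simp only [LinearMap.add_apply, LinearMap.smul_apply, smul_eq_mul]
      linarith
    · simp only [LinearMap.add_apply, LinearMap.smul_apply, smul_eq_mul]
      constructor <;> intro h <;> linarith
  · simp [hg i hi, ((hF i).1 hi).2]
  · refine hp.2 (h ⟨hp.1, ?_⟩)
    exact (div_mul_cancel₀ _ (ne_of_gt (hpos p hp.1 hp.2))).symm

/-- A minimal face strictly containing `F` has dimension at most `dim F + 1`. -/
theorem IsSubdivision.dim_le_of_minimal (hS : IsSubdivision a S) (hF : F ∈ S) (hFne : F.Nonempty)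
    (hG : G ∈ S) (hFG : F ⊂ G) (hmin : ∀ H ∈ S, F ⊂ H → H ⊆ G → H = G) :
    dim a G ≤ dim a F + 1 := by
  obtain ⟨p, hpG, hpF⟩ := exists_of_ssubset hFG
  obtain ⟨f, c, hf, hfF⟩ := hS.isLinFace_of_subset hF hG hFG.subset hFne
  obtain ⟨x, hx⟩ := exists_isPosComb (a := a) hFne
  have hmem : ∀ q ∈ G, a q - x ∈ vectorSpan ℝ (a '' F) ⊔ Submodule.span ℝ {a p - x} := by
    intro q hq
    by_contra hn
    obtain ⟨g, hgq, hg⟩ := Submodule.exists_le_ker_of_notMem hn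
    have hgF : ∀ i ∈ F, g (a i) = g x := fun i hi => by
      have h1 : g (a i - x) = 0 :=
        hg (Submodule.mem_sup_left (sub_mem_vectorSpan hx.mem_conv (mem_conv_of_mem hi)))
      rwa [map_sub, sub_eq_zero] at h1
    obtain ⟨t, -, ht, hFt⟩ := exists_tilted_face hf hfF hgF ⟨p, hpG, hpF⟩
    have heq := hmin _ (hS.linFace_mem hG ht) hFt ht.subset
    have hp' := (heq.symm.subset hpG).2
    have hq' := (heq.symm.subset hq).2
    have hgp : g (a p - x) = 0 :=
      hg (Submodule.mem_sup_right (Submodule.mem_span_singleton_self _))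
    rw [← map_sub] at hp' hq'
    rw [hgp] at hp'
    rcases mul_eq_zero.1 hp'.symm with h0 | h0
    · rw [h0, zero_mul] at hq'
      exact hgq hq'
    · exact hpF ((hfF p).2 ⟨hpG, by linarith⟩)
  have hle : vectorSpan ℝ (a '' G) ≤ vectorSpan ℝ (a '' F) ⊔ Submodule.span ℝ {a p - x} := by
    rw [vectorSpan_def, Submodule.span_le]
    rintro _ ⟨_, ⟨i, hi, rfl⟩, _, ⟨j, hj, rfl⟩, rfl⟩
    simpa using Submodule.sub_mem _ (hmem i hi) (hmem j hj)
  calc dim a G ≤ _ := Submodule.finrank_mono hle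
    _ ≤ _ := Submodule.finrank_add_le_finrank_add_finrank _ _
    _ ≤ dim a F + 1 := Nat.add_le_add_left ((finrank_span_le_card _).trans (by simp)) _

/-- If there are only `codim F + 1` maximal faces, then for each of them there is a label that
belongs to all the other ones but not to it. -/
theorem IsSubdivision.exists_ray (hS : IsSubdivision a S) (hF : F ∈ S) (hFx : IsPosComb a F x)
    (hx : x ∈ interior (conv a univ)) (hcells : ∀ C : {C // Maximal (· ∈ S) C}, F ⊆ C)
    (hdim : dim a F + Nat.card {C // Maximal (· ∈ S) C} = d + 1)
    {C D : {C // Maximal (· ∈ S) C}} (hDC : D ≠ C) :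
    ∃ p, ∀ B : {C // Maximal (· ∈ S) C}, p ∈ (B : Set ι) ↔ C ≠ B := by
  classical
  have hFne := hFx.nonempty
  obtain ⟨f, c, hf, hfF⟩ := hS.isLinFace_of_subset hF D.2.prop (hcells D) hFne
  obtain ⟨g, e, hg, hgC⟩ := hS.isLinFace_inter D.2.prop C.2.prop
    (hFne.mono (subset_inter (hcells D) (hcells C)))
  obtain ⟨q, hqD, hqC⟩ : ∃ q ∈ (D : Set ι), q ∉ (C : Set ι) := by
    by_contra! h
    exact hDC (Subtype.ext (D.2.eq_of_subset C.2.prop h))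
  obtain ⟨t, hle, ht, hFt⟩ := exists_tilted_face (g := -g) (e := -e) hf hfF (fun i hi => by
    simp [((hgC i).1 ⟨hcells D hi, hcells C hi⟩).2]) ⟨q, hqD, fun h => hqC (hcells C h)⟩
  simp only [LinearMap.neg_apply] at hle ht hFt
  set H := {i | i ∈ (D : Set ι) ∧ -g (a i) - -e = t * (c - f (a i))}
  have hHC : ∀ i ∈ H, i ∈ (C : Set ι) → i ∈ F := by
    rintro i ⟨hiD, hi⟩ hiC
    have h1 := ((hgC i).1 ⟨hiD, hiC⟩).2
    have h2 := hle q hqD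
    have h3 : g (a q) < e := lt_of_le_of_ne (hg q hqD) fun h => hqC ((hgC q).2 ⟨hqD, h⟩).2
    rw [h1, sub_self] at hi
    rcases mul_eq_zero.1 hi.symm with h | h
    · rw [h, zero_mul] at h2
      linarith
    · exact (hfF i).2 ⟨hiD, by linarith⟩
  obtain ⟨G, hGH, hG⟩ := (toFinite {G | G ∈ S ∧ F ⊂ G}).exists_le_minimal
    (a := H) ⟨hS.linFace_mem D.2.prop ht, hFt⟩
  have hdimG := hS.dim_le_of_minimal hF hFne hG.prop.1 hG.prop.2 fun B hB hFB hBG =>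
    hG.eq_of_subset ⟨hB, hFB⟩ hBG
  obtain ⟨z, hzG, hz⟩ := exists_isPosComb_interior
    (conv_mono hG.prop.2.subset hFx.mem_conv) hx
  have hcard := hS.le_dim_add_card hG.prop.1 hzG hz
  obtain ⟨p, hpG, hpF⟩ := exists_of_ssubset hG.prop.2
  have hpC : p ∉ (C : Set ι) := fun h => hpF (hHC p (hGH hpG) h)
  refine ⟨p, fun B => ⟨?_, fun hB => ?_⟩⟩
  · rintro hpB rfl
    exact hpC hpB
  · by_contra hpB
    have : Fintype {C // Maximal (· ∈ S) C} := Fintype.ofFinite _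
    have h1 : Nat.card {C : {C // Maximal (· ∈ S) C} // G ⊆ C}
        ≤ ((Finset.univ.erase C).erase B).card := by
      rw [Nat.card_eq_fintype_card, Fintype.card_subtype]
      refine Finset.card_le_card fun A hA => ?_
      have hA' : G ⊆ A := by simpa using hA
      simp only [Finset.mem_erase, Finset.mem_univ, and_true]
      exact ⟨fun h => hpB (h ▸ hA' hpG), fun h => hpC (h ▸ hA' hpG)⟩
    rw [Finset.card_erase_of_mem (by simpa using hB.symm),
      Finset.card_erase_of_mem (Finset.mem_univ _), Finset.card_univ,
      ← Nat.card_eq_fintype_card] at h1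
    have h2 : 1 < Nat.card {C // Maximal (· ∈ S) C} :=
      Finite.one_lt_card_iff_nontrivial.2 ⟨C, B, hB⟩
    lia

end Cells

end PointConfig

namespace PointConfig
open Set Filter Topology

variable {d : ℕ} {ι : Type*}
variable {a : ι → EuclideanSpace ℝ (Fin d)} {F : Set ι} {S : Set (Set ι)} {w : ι → ℝ}

theorem lifted_mem_lift (i : ι) : (w i, a i) ∈ lift a w :=
  ⟨_, subset_convexHull ℝ _ (mem_range_self i), 0, le_rfl, by simp⟩

theorem add_mem_lift {x : ℝ × EuclideanSpace ℝ (Fin d)} (hx : x ∈ lift a w) {t : ℝ} (ht : 0 ≤ t) :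
    x + (t, 0) ∈ lift a w := by
  obtain ⟨y, hy, s, hs, rfl⟩ := hx
  exact ⟨y, hy, s + t, by positivity, by rw [add_assoc]; simp⟩

/-- A nonempty bounded face of the lifted polyhedron is cut out by an affine function below `w`. -/
theorem exists_affine_of_bounded_face {G : Set (ℝ × EuclideanSpace ℝ (Fin d))}
    (hG : IsExposed ℝ (lift a w) G) (hb : Bornology.IsBounded G) (hne : G.Nonempty) :
    ∃ (u : EuclideanSpace ℝ (Fin d) →ₗ[ℝ] ℝ) (c : ℝ), (∀ i, u (a i) + c ≤ w i) ∧
      ∀ i, (w i, a i) ∈ G ↔ u (a i) + c = w i := by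
  obtain ⟨l, rfl⟩ := hG hne
  obtain ⟨x, hx, hmax⟩ := hne
  have hdec : ∀ (t : ℝ) (v : EuclideanSpace ℝ (Fin d)), l (t, v) = t * l (1, 0) + l (0, v) := by
    intro t v
    rw [← smul_eq_mul, ← map_smul, ← map_add]
    simp
  have hle : l (1, 0) ≤ 0 := by
    have := hmax _ (add_mem_lift hx zero_le_one)
    rw [map_add] at this
    linarith
  have hlt : l (1, 0) < 0 := by
    refine lt_of_le_of_ne hle fun h0 => ?_
    obtain ⟨R, hR⟩ := hb.exists_norm_le
    have hmem : ∀ t : ℝ, 0 ≤ t →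
        x + (t, 0) ∈ {x ∈ lift a w | ∀ y ∈ lift a w, l y ≤ l x} := fun t ht =>
      ⟨add_mem_lift hx ht, fun y hy => by
        have h00 : l (0, 0) = 0 := map_zero l
        rw [map_add, hdec t 0, h0, h00, mul_zero, add_zero, add_zero]
        exact hmax y hy⟩
    have h1 := hR _ (hmem (|R| + |x.1| + 1) (by positivity))
    have h2 : ‖(x + (|R| + |x.1| + 1, (0 : EuclideanSpace ℝ (Fin d)))).1‖ ≤ R :=
      (norm_fst_le _).trans h1
    rw [Prod.fst_add, Real.norm_eq_abs] at h2
    have h3 := (le_abs_self _).trans h2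
    linarith [neg_abs_le x.1, le_abs_self R]
  have hval : ∀ i, ((-(l (1, 0))⁻¹) • (l.toLinearMap ∘ₗ LinearMap.inr ℝ ℝ
      (EuclideanSpace ℝ (Fin d)))) (a i) + l x / l (1, 0) = (l x - l (0, a i)) / l (1, 0) := by
    intro i
    simp only [LinearMap.smul_apply, LinearMap.comp_apply, LinearMap.inr_apply, smul_eq_mul,
      ContinuousLinearMap.coe_coe]
    ring
  refine ⟨(-(l (1, 0))⁻¹) • (l.toLinearMap ∘ₗ LinearMap.inr ℝ ℝ _), l x / l (1, 0),
    fun i => ?_, fun i => ?_⟩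
  · rw [hval, div_le_iff_of_neg hlt]
    have := hmax _ (lifted_mem_lift i)
    rw [hdec] at this
    linarith
  · rw [hval, div_eq_iff hlt.ne]
    have h1 := hmax _ (lifted_mem_lift i)
    constructor
    · rintro ⟨-, h⟩
      have h2 := h x hx
      rw [hdec (w i)] at h1 h2
      linarith
    · refine fun h => ⟨lifted_mem_lift i, fun y hy => (hmax y hy).trans ?_⟩
      rw [hdec (w i)]
      linarith

/-- The labels where an affine function below `w` touches `w` form a face of the regular
subdivision. -/
theorem mem_regularSubdivision_of_affine [Finite ι] {u : EuclideanSpace ℝ (Fin d) →ₗ[ℝ] ℝ} {c : ℝ}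
    (hle : ∀ i, u (a i) + c ≤ w i) (hF : ∀ i, i ∈ F ↔ u (a i) + c = w i) (hne : F.Nonempty) :
    F ∈ regularSubdivision a w := by
  obtain ⟨j, hj⟩ := hne
  let l : ℝ × EuclideanSpace ℝ (Fin d) →ₗ[ℝ] ℝ :=
    u ∘ₗ LinearMap.snd ℝ ℝ _ - LinearMap.fst ℝ ℝ _
  have hl : ∀ x, l x = u x.2 - x.1 := fun x => rfl
  have hhull : ∀ y ∈ convexHull ℝ (range fun i => (w i, a i)), l y ≤ -c := by
    intro y hy
    refine convexHull_min (t := {x | l x ≤ -c}) ?_ (convex_halfSpace_le l.isLinear (-c)) hy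
    rintro _ ⟨i, rfl⟩
    simp only [mem_ofPred_eq, hl]
    linarith [hle i]
  have hlift : ∀ y ∈ lift a w, l y ≤ -c := by
    rintro _ ⟨y, hy, t, ht, rfl⟩
    have := hhull y hy
    rw [hl] at this ⊢
    simp only [Prod.snd_add, Prod.fst_add, add_zero]
    linarith
  have hlj : l (w j, a j) = -c := by
    rw [hl]
    linarith [(hF j).1 hj]
  refine ⟨_, ContinuousLinearMap.toExposed.isExposed (l := l.toContinuousLinearMap), ?_, ?_⟩
  · refine ((finite_range fun i => (w i, a i)).isCompact_convexHull (𝕜 := ℝ)).isBounded.subset ?_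
    rintro _ ⟨⟨y, hy, t, ht, rfl⟩, hmax⟩
    have h1 : l (w j, a j) ≤ l (y + (t, 0)) := hmax _ (lifted_mem_lift j)
    have h2 := hhull y hy
    rw [hlj, hl] at h1
    rw [hl] at h2
    simp only [Prod.snd_add, Prod.fst_add, add_zero] at h1
    have : t = 0 := by linarith
    subst this
    change y + 0 ∈ _
    rwa [add_zero]
  · ext i
    rw [hF i]
    constructor
    · refine fun h => ⟨lifted_mem_lift i, fun y hy => ?_⟩
      have h1 : l (w i, a i) = -c := by rw [hl]; linarith
      exact (hlift y hy).trans h1.ge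
    · rintro ⟨-, h⟩
      have h1 : l (w j, a j) ≤ l (w i, a i) := h _ (lifted_mem_lift j)
      rw [hlj, hl] at h1
      exact le_antisymm (hle i) (by linarith)

theorem empty_mem_regularSubdivision : ∅ ∈ regularSubdivision a w :=
  ⟨∅, isExposed_empty, Bornology.isBounded_empty, by simp⟩

/-- A subdivision is regular if each maximal face is the set of labels where some affine function
below `w` touches `w`. -/
theorem IsSubdivision.eq_regularSubdivision [Fintype ι] (hS : IsSubdivision a S) (hne : S.Nonempty)
    (g : {C // Maximal (· ∈ S) C} → EuclideanSpace ℝ (Fin d) →ₗ[ℝ] ℝ)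
    (e : {C // Maximal (· ∈ S) C} → ℝ) (hle : ∀ C i, g C (a i) + e C ≤ w i)
    (heq : ∀ (C : {C // Maximal (· ∈ S) C}) i, i ∈ (C : Set ι) ↔ g C (a i) + e C = w i) :
    S = regularSubdivision a w := by
  have hempty : ∅ ∈ S := by
    obtain ⟨B, hB⟩ := hne
    exact hS.face_mem B hB ∅ ⟨∅, isExposed_empty, by simp⟩
  ext F
  rcases F.eq_empty_or_nonempty with rfl | hFne
  · exact iff_of_true hempty empty_mem_regularSubdivision
  constructor
  · intro hF
    obtain ⟨C, hC, hFC⟩ := exists_cell_superset hF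
    obtain ⟨f, c, hf, hfF⟩ := hS.isLinFace_of_subset hF hC.prop hFC hFne
    let D : {C // Maximal (· ∈ S) C} := ⟨C, hC⟩
    have hD : ∀ i, i ∈ C ↔ g D (a i) + e D = w i := heq D
    have : ∀ᶠ t in 𝓝[>] (0 : ℝ), ∀ i : ι, i ∉ C →
        g D (a i) + e D + t * (f (a i) - c) < w i := by
      rw [eventually_all]
      intro i
      by_cases hi : i ∈ C
      · exact Eventually.of_forall fun _ h => absurd hi h
      · have hlt : g D (a i) + e D < w i :=
          lt_of_le_of_ne (hle D i) fun h => hi ((hD i).2 h)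
        have hcont : Continuous fun t : ℝ => g D (a i) + e D + t * (f (a i) - c) := by fun_prop
        have ht := hcont.tendsto 0
        simp only [zero_mul, add_zero] at ht
        filter_upwards [nhdsWithin_le_nhds (ht.eventually_lt_const hlt)] with t ht _ using ht
    obtain ⟨t, ht, ht0⟩ := (this.and self_mem_nhdsWithin).exists
    have ht0' : 0 < t := ht0
    have hval : ∀ i, (g D + t • f) (a i) + (e D - t * c)
        = g D (a i) + e D + t * (f (a i) - c) := fun i => by
      simp only [LinearMap.add_apply, LinearMap.smul_apply, smul_eq_mul]
      ring
    refine mem_regularSubdivision_of_affine (u := g D + t • f) (c := e D - t * c)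
      (fun i => ?_) (fun i => ?_) hFne
    · rw [hval]
      by_cases hi : i ∈ C
      · rw [(hD i).1 hi]
        nlinarith [hf i hi]
      · exact (ht i hi).le
    · rw [hval]
      by_cases hi : i ∈ C
      · rw [(hD i).1 hi, hfF i, add_eq_left, mul_eq_zero, sub_eq_zero]
        simp [hi, ht0'.ne']
      · exact iff_of_false (fun h => hi (hFC h)) (ht i hi).ne
  · rintro ⟨G, hG, hb, hFG⟩
    have hGne : G.Nonempty := by
      obtain ⟨i, hi⟩ := hFne
      rw [hFG] at hi
      exact ⟨_, hi⟩
    obtain ⟨u, c, hu, huG⟩ := exists_affine_of_bounded_face hG hb hGne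
    have huF : ∀ i, i ∈ F ↔ u (a i) + c = w i := fun i => by rw [← huG i, hFG]; rfl
    obtain ⟨z, hz⟩ := exists_isPosComb (a := a) hFne
    obtain ⟨C, hC, hzC⟩ := hS.exists_cell (conv_mono (subset_univ F) hz.mem_conv)
    let D : {C // Maximal (· ∈ S) C} := ⟨C, hC⟩
    have hD : ∀ i, i ∈ C ↔ g D (a i) + e D = w i := heq D
    have hleC : ∀ i ∈ C, (u - g D) (a i) ≤ e D - c := fun i hi => by
      have := hu i
      rw [← (hD i).1 hi] at this
      rw [LinearMap.sub_apply]
      linarith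
    have hleF : ∀ i ∈ F, (g D - u) (a i) ≤ c - e D := fun i hi => by
      have := hle D i
      rw [← (huF i).1 hi] at this
      rw [LinearMap.sub_apply]
      linarith
    have hzval : (g D - u) z = c - e D := by
      have h1 := le_of_mem_conv hleC hzC
      have h2 := le_of_mem_conv hleF hz.mem_conv
      rw [LinearMap.sub_apply] at h1 h2 ⊢
      linarith
    have hface : IsLinFace a {i | i ∈ F ∧ (g D - u) (a i) = c - e D} F :=
      ⟨g D - u, c - e D, hleF, fun i => Iff.rfl⟩
    have hFC : F ⊆ C := fun i hi => by
      have h1 := (hface.subset_of_isPosComb subset_rfl hz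
        (mem_conv_eq hleF hz.mem_conv hzval) hi).2
      rw [hD, ← (huF i).1 hi]
      rw [LinearMap.sub_apply] at h1
      linarith
    refine hS.linFace_mem hC.prop ⟨u - g D, e D - c, hleC, fun i => ?_⟩
    constructor
    · intro hi
      refine ⟨hFC hi, ?_⟩
      have h1 := (huF i).1 hi
      rw [← (hD i).1 (hFC hi)] at h1
      rw [LinearMap.sub_apply]
      linarith
    · rintro ⟨hi, h⟩
      rw [huF, ← (hD i).1 hi]
      rw [LinearMap.sub_apply] at h
      linarith

end PointConfig

namespace PointConfig
open Set Filter Topology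

variable {d : ℕ} {ι : Type*} {a : ι → EuclideanSpace ℝ (Fin d)} {F : Set ι} {S : Set (Set ι)}

/-- A subdivision that has an interior face `F` and at most `codim F + 1` maximal faces is the
subdivision of the configuration by the maximal cones of a strictly convex fan. -/
theorem IsSubdivision.exists_supporting_functionals [Fintype ι] (hS : IsSubdivision a S)
    (hF : F ∈ S) (hint : IsInterior a F)
    (hdim : dim a F + Nat.card {C // Maximal (· ∈ S) C} = d + 1) :
    ∃ (x : EuclideanSpace ℝ (Fin d))
      (h : {C // Maximal (· ∈ S) C} → EuclideanSpace ℝ (Fin d) →ₗ[ℝ] ℝ),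
      ∀ (C : {C // Maximal (· ∈ S) C}), ∀ i ∈ (C : Set ι), ∀ D : {C // Maximal (· ∈ S) C},
        h D (a i - x) ≤ h C (a i - x) ∧ (h D (a i - x) = h C (a i - x) ↔ i ∈ (D : Set ι)) := by
  classical
  obtain ⟨x, hFx, hx⟩ := hint.exists_isPosComb
  have hfin : Fintype {C // Maximal (· ∈ S) C} := Fintype.ofFinite _
  have hcells : ∀ C : {C // Maximal (· ∈ S) C}, F ⊆ C := by
    intro C
    by_contra hC
    have h1 := hS.le_dim_add_card hF hFx hx
    have h2 : Nat.card {C : {C // Maximal (· ∈ S) C} // F ⊆ C}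
        < Nat.card {C // Maximal (· ∈ S) C} := by
      rw [Nat.card_eq_fintype_card, Nat.card_eq_fintype_card]
      exact Fintype.card_subtype_lt hC
    lia
  have hxC : ∀ C : {C // Maximal (· ∈ S) C}, x ∈ conv a C := fun C =>
    conv_mono (hcells C) hFx.mem_conv
  refine ⟨x, ?_⟩
  by_cases hsub : ∃ C D : {C // Maximal (· ∈ S) C}, C ≠ D
  · have hother : ∀ C : {C // Maximal (· ∈ S) C}, ∃ D, D ≠ C := by
      obtain ⟨A, B, hAB⟩ := hsub
      intro C
      by_cases h : A = C
      · exact ⟨B, fun h' => hAB (h.trans h'.symm)⟩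
      · exact ⟨A, h⟩
    have hne : Nonempty {C // Maximal (· ∈ S) C} := ⟨hsub.choose⟩
    choose p hp using fun C => hS.exists_ray hF hFx hx hcells hdim (hother C).choose_spec
    have hrays : ∀ C D : {C // Maximal (· ∈ S) C}, a (p C) - x ∈ dirCone a x D ↔ C ≠ D := by
      refine fun C D => ⟨fun hm => ?_, fun hCD => sub_mem_dirCone (hxC D)
        (mem_conv_of_mem ((hp C D).2 hCD))⟩
      obtain ⟨B, hB⟩ := hother C
      exact (hp C D).1 (hS.mem_of_sub_mem_dirCone B.2.prop D.2.prop (hxC B)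
        ((hp C B).2 hB.symm) hm)
    rw [Nat.card_eq_fintype_card] at hdim
    obtain ⟨h, hh⟩ := PointConfig.exists_supporting_functionals
      (K := fun C : {C // Maximal (· ∈ S) C} => dirCone a x C) (r := fun C => a (p C) - x)
      (V := vectorSpan ℝ (a '' F)) (by rw [finrank_euclideanSpace_fin]; exact hdim.symm)
      (fun C v hv => dirCone_mono (hcells C) (vectorSpan_subset_dirCone hFx hv))
      (fun C y hy z hz => add_mem_dirCone hy hz)
      (fun C t ht y hy => smul_mem_dirCone ht hy)
      (fun C D y hy z hz hyz => hS.mem_dirCone_of_add_mem C.2.prop D.2.prop hy hz hyz)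
      hrays
    refine ⟨h, fun C i hi D => ?_⟩
    obtain ⟨h1, h2⟩ := hh C (a i - x) (sub_mem_dirCone (hxC C) (mem_conv_of_mem hi)) D
    refine ⟨h1, h2.trans ⟨fun h3 => ?_, fun h3 => ?_⟩⟩
    · exact hS.mem_of_sub_mem_dirCone C.2.prop D.2.prop (hxC C) hi h3
    · exact sub_mem_dirCone (hxC D) (mem_conv_of_mem h3)
  · push Not at hsub
    refine ⟨0, fun C i hi D => ⟨le_rfl, iff_of_true rfl ?_⟩⟩
    rwa [← hsub C D]

end PointConfig

theorem mainTheorem1 {d : ℕ} {ι : Type*} [Finite ι] (a : ι → EuclideanSpace ℝ (Fin d))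
    (hdim : affineSpan ℝ (Set.range a) = ⊤) (k : ℕ) (S : Set (Set ι))
    (hS : PointConfig.IsKSplit a k S) :
    PointConfig.IsRegular a S := by
  classical
  have : Fintype ι := Fintype.ofFinite ι
  obtain ⟨F, hF, hint, hk⟩ := hS.exists_interior
  have hsub := hS.isCoarsest.isSubdivision
  have hcard : Nat.card {C // Maximal (· ∈ S) C} = k := hS.ncard_maximal
  obtain ⟨x, h, hh⟩ := hsub.exists_supporting_functionals hF hint (by rw [hcard]; exact hk)
  have hfin : Fintype {C // Maximal (· ∈ S) C} := Fintype.ofFinite _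
  let w : ι → ℝ := fun i =>
    if hi : ∃ C : {C // Maximal (· ∈ S) C}, i ∈ (C : Set ι) then h hi.choose (a i - x)
    else ∑ C, |h C (a i - x)| + 1
  have key : ∀ (C : {C // Maximal (· ∈ S) C}) i, h C (a i - x) ≤ w i ∧
      (i ∈ (C : Set ι) ↔ h C (a i - x) = w i) := by
    intro C i
    by_cases hi : ∃ C : {C // Maximal (· ∈ S) C}, i ∈ (C : Set ι)
    · obtain ⟨h1, h2⟩ := hh hi.choose i hi.choose_spec C
      simp only [w, dif_pos hi]
      exact ⟨h1, h2.symm⟩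
    · have h1 : h C (a i - x) < w i := by
        simp only [w, dif_neg hi]
        have h2 := Finset.single_le_sum (f := fun C => |h C (a i - x)|)
          (fun C _ => abs_nonneg _) (Finset.mem_univ C)
        have h3 := le_abs_self (h C (a i - x))
        linarith
      exact ⟨h1.le, iff_of_false (fun h4 => hi ⟨C, h4⟩) h1.ne⟩
  refine ⟨w, hsub.eq_regularSubdivision ⟨F, hF⟩ h (fun C => -h C x) (fun C i => ?_) fun C i => ?_⟩
  · rw [← sub_eq_add_neg, ← map_sub]
    exact (key C i).1
  · rw [← sub_eq_add_neg, ← map_sub]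
    exact (key C i).2
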